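/- Graphs are finite and have no loops, but may have parallel edges; two parallel edges form a cycle (of length 2). Let $V_2(G)$ denote the set of vertices of degree $2$ of a graph $G$. A cycle $C$ of a connected graph $G$ is separating if the graph $G\setminus E(C)$, obtained by deleting the edges of $C$ and keeping all vertices, is disconnected. A cactus is a connected graph in which every edge is contained in at most one cycle; it is thick if every vertex belongs to a cycle. A graph decomposes into a spanning tree and a matching if its edge set is the disjoint union of the edge set of a spanning tree and a (possibly empty) matching. Theorem. Let $G$ be a connected graph in which every vertex has degree $2$ or $3$ and every cycle is separating. If $G - V_2(G)$ is a (possibly empty) collection of thick cacti, i.e. every connected component of $G - V_2(G)$ is a thick cactus, then $G$ decomposes into a spanning tree and a matching. -/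

import Mathlib

/-!
Multigraphs are Mathlib's `Graph α β`: a set of vertices, a set of edges, and incidences.
Parallel edges are distinct elements of the edge set with the same ends.
-/

namespace Graph

variable {α β : Type*}

/-- The degree of a vertex: the number of edges incident to it.
(Only used for graphs without loops.) -/
noncomputable def degree (G : Graph α β) (v : α) : ℕ :=
  {e | G.Inc e v}.ncard

/-- `V_k(G)`, the set of vertices of degree `k`. -/
def verticesOfDegree (G : Graph α β) (k : ℕ) : Set α :=
  {v | v ∈ G.vertexSet ∧ G.degree v = k}

/-- A graph is connected if it has a vertex and any two vertices are joined by a walk. -/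
def Connected (G : Graph α β) : Prop :=
  G.vertexSet.Nonempty ∧
    ∀ x ∈ G.vertexSet, ∀ y ∈ G.vertexSet, Relation.ReflTransGen G.Adj x y

/-- A graph (without loops) is a cycle if it is finite, connected and 2-regular. Two parallel
edges form a cycle. -/
def IsCycle (C : Graph α β) : Prop :=
  C.vertexSet.Finite ∧ C.Connected ∧ ∀ v ∈ C.vertexSet, C.degree v = 2

/-- `C` is a cycle of `G`, i.e. a subgraph of `G` that is a cycle. -/
def IsCycleOf (C G : Graph α β) : Prop :=
  C ≤ G ∧ C.IsCycle

/-- The class `S_{p,q}`: finite loopless connected graphs `G` with minimum degree at least `p` and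
maximum degree at most `q` in which every cycle `C` is separating, i.e. removing the edges of `C`
from `G` (and keeping all vertices) leaves a disconnected graph. -/
structure SepCycleClass (p q : ℕ) (G : Graph α β) : Prop where
  finite_vertexSet : G.vertexSet.Finite
  finite_edgeSet : G.edgeSet.Finite
  loopless : G.Loopless
  connected : G.Connected
  separating : ∀ C : Graph α β, C.IsCycleOf G → ¬ (G.deleteEdges C.edgeSet).Connected
  le_degree : ∀ v ∈ G.vertexSet, p ≤ G.degree v
  degree_le : ∀ v ∈ G.vertexSet, G.degree v ≤ q

/-- `H` is a component of `G`: a maximal connected subgraph. -/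
def IsComponentOf (H G : Graph α β) : Prop :=
  Maximal (fun K : Graph α β => K ≤ G ∧ K.Connected) H

/-- A cactus: a connected graph in which every edge is contained in at most one cycle. -/
def IsCactus (H : Graph α β) : Prop :=
  H.Connected ∧ ∀ e ∈ H.edgeSet, ∀ C D : Graph α β, C.IsCycleOf H → D.IsCycleOf H →
    e ∈ C.edgeSet → e ∈ D.edgeSet → C = D

/-- A thick cactus: a cactus in which every vertex belongs to a cycle. -/
def IsThickCactus (H : Graph α β) : Prop :=
  H.IsCactus ∧ ∀ v ∈ H.vertexSet, ∃ C : Graph α β, C.IsCycleOf H ∧ v ∈ C.vertexSet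

/-- A (possibly empty) collection of thick cacti: every component is a thick cactus. -/
def IsCollectionOfThickCacti (G : Graph α β) : Prop :=
  ∀ H : Graph α β, H.IsComponentOf G → H.IsThickCactus

/-- A tree: a connected graph without cycles. -/
def IsTree (T : Graph α β) : Prop :=
  T.Connected ∧ ∀ C : Graph α β, ¬ C.IsCycleOf T

/-- A (possibly empty) matching of a loopless graph `G`: a set of edges of `G`, no two of which
share an end. -/
def IsMatching (G : Graph α β) (M : Set β) : Prop :=
  M ⊆ G.edgeSet ∧ ∀ e ∈ M, ∀ f ∈ M, ∀ v, G.Inc e v → G.Inc f v → e = f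

/-- The edge set of `G` is partitioned into the edges of a spanning tree and a matching. -/
def DecomposesIntoSpanningTreeAndMatching (G : Graph α β) : Prop :=
  ∃ (T : Graph α β) (M : Set β), T.IsSpanningSubgraph G ∧ T.IsTree ∧ G.IsMatching M ∧
    Disjoint T.edgeSet M ∧ T.edgeSet ∪ M = G.edgeSet

end Graph

/-! Call the cycles of `G - V_2(G)` cubic cycles. At a vertex of degree at most 3 two of them share
an edge, so in a cactus they are vertex-disjoint; by thickness they cover all vertices of degree 3.
Deleting one edge from each leaves `G` connected. Let `F` be the set of these edges and `N` a
maximal set of edges at degree-two vertices, avoiding the ends of `F`, whose further deletion keeps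
the graph connected. Then `F ∪ N` is a matching. A cycle in the remaining graph is not cubic, so it
passes through some `w` of degree two; by maximality of `N` both neighbours of `w` are ends of `F`.

So `F` must be chosen such that no such `w` has two distinct neighbours at chosen edges
(`exists_edge_choice`). Fix a root `r`. As every cycle is separating, each cubic cycle `C` has edges
`b x` leaving the part of `G - E(C)` that contains `r`; take two as candidates. The cycles that cut
`C` off from `r` are its ancestors. Both neighbours of `w` lie on the same side of every cubic
cycle, so clashes occur only between the `b`-ends of siblings, or between a parent's `x`-end and a
child's `b`-end. Working down the hierarchy, Hall's theorem settles each family of siblings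
(`exists_bool_choice`). If both candidates have the same `b`-end, the edge from `b` to `w` is a
bridge and `w` is on no cycle (`notMem_cycle_of_unique`). -/

/-! ### Hall's theorem along a hierarchy. -/

/-- Choosing for each index one of two vertices so that labels of chosen vertices do not clash,
when the possible clashes respect a hierarchy `A` and every label is used at most twice. -/
lemma exists_bool_choice {ι V W : Type*} [Finite ι] (A : ι → Set ι) (b x : ι → Bool → V)
    (o : V → W)
    (hb : ∀ i k a a', b i a = b k a' → i = k)
    (hbx : ∀ i k a a', b i a ≠ x k a')
    (ho : ∀ u v t, o u = o v → o v = o t → u = v ∨ v = t ∨ u = t)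
    (hbb : ∀ i k a a', o (b i a) = o (b k a') → i ≠ k → A i = A k)
    (hxb : ∀ l i a a', o (x l a) = o (b i a') → A i = insert l (A l))
    (hA : ∀ l l', l ∈ A l' → l' ∉ A l) :
    ∃ c : ι → Bool,
      (∀ i k, i ≠ k → b i true ≠ b i false → b k true ≠ b k false →
        o (b i (c i)) ≠ o (b k (c k))) ∧
      (∀ i l, b i true ≠ b i false → o (x l (c l)) ≠ o (b i (c i))) := by
  classical
  have := Fintype.ofFinite ι
  -- One family of siblings `A i = Q`, with the parent's choice already fixed by `c`.
  have hstep : ∀ (c : ι → Bool) (Q : Set ι), ∃ c' : ι → Bool,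
      (∀ i k, A i = Q → A k = Q → i ≠ k → b i true ≠ b i false → b k true ≠ b k false →
        o (b i (c' i)) ≠ o (b k (c' k))) ∧
      (∀ i l, A i = Q → b i true ≠ b i false → o (x l (c l)) ≠ o (b i (c' i))) := by
    intro c Q
    let J := {i : ι // A i = Q ∧ b i true ≠ b i false}
    let T : Set W := Set.range fun l => o (x l (c l))
    let t : J → Finset W := fun i =>
      (Finset.univ.filter fun a => o (b i.1 a) ∉ T).image fun a => o (b i.1 a)
    have hbinj : ∀ p q : J × Bool, b p.1.1 p.2 = b q.1.1 q.2 → p = q := by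
      rintro ⟨⟨i, hi⟩, a⟩ ⟨⟨k, hk⟩, a'⟩ h
      obtain rfl := hb _ _ _ _ h
      have hne := hi.2
      cases a <;> cases a' <;> first | rfl | exact absurd h hne | exact absurd h.symm hne
    have hall : ∀ s : Finset J, s.card ≤ (s.biUnion t).card := by
      intro s
      let P : Finset (J × Bool) := s ×ˢ Finset.univ
      let φ : J × Bool → W := fun p => o (b p.1.1 p.2)
      have hP : P.card = s.card * 2 := by simp [P]
      have hsplit := Finset.card_filter_add_card_filter_not (s := P) fun p => φ p ∉ T
      -- A blocking `l` satisfies `Q = insert l (A l)`, so by `hA` it is unique. Its label is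
      -- carried by at most two vertices, one of which is `x l (c l)`.
      have hbad : (P.filter fun p => ¬ φ p ∉ T).card ≤ 1 := by
        refine Finset.card_le_one.2 fun p hp q hq => ?_
        simp only [Finset.mem_filter, not_not] at hp hq
        obtain ⟨l, hl⟩ := hp.2
        obtain ⟨l', hl'⟩ := hq.2
        have hl1 : o (x l (c l)) = o (b p.1.1 p.2) := hl
        have hl2 : o (x l' (c l')) = o (b q.1.1 q.2) := hl'
        have h1 := hxb _ _ _ _ hl1
        have h2 := hxb _ _ _ _ hl2
        rw [p.1.2.1] at h1
        rw [q.1.2.1] at h2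
        have hll : l = l' := by
          by_contra hne
          have h3 : l ∈ insert l' (A l') := h2 ▸ h1 ▸ Set.mem_insert _ _
          have h4 : l' ∈ insert l (A l) := h1 ▸ h2 ▸ Set.mem_insert _ _
          exact hA _ _ (h3.resolve_left hne) (h4.resolve_left (Ne.symm hne))
        subst hll
        rcases ho _ _ _ hl1.symm hl2 with h | h | h
        · exact absurd h (hbx _ _ _ _)
        · exact absurd h.symm (hbx _ _ _ _)
        · exact hbinj _ _ h
      have himg : ((P.filter fun p => φ p ∉ T).image φ) ⊆ s.biUnion t := by
        intro w hw
        simp only [Finset.mem_image, Finset.mem_filter, Finset.mem_product, P, φ] at hw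
        obtain ⟨⟨i, a⟩, ⟨⟨his, -⟩, hT⟩, rfl⟩ := hw
        simp only [Finset.mem_biUnion, t, Finset.mem_image, Finset.mem_filter]
        exact ⟨i, his, a, ⟨Finset.mem_univ _, hT⟩, rfl⟩
      -- At least `2 * s.card - 1` unblocked pairs remain and each label serves at most two of them,
      -- hence at least `s.card` labels: Hall's condition.
      have hfib := Finset.card_le_mul_card_image (f := φ) (P.filter fun p => φ p ∉ T) 2 (by
        intro w _
        by_contra! hlt
        obtain ⟨p, q, r, hp, hq, hr, hpq, hpr, hqr⟩ := Finset.two_lt_card_iff.1 hlt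
        simp only [Finset.mem_filter] at hp hq hr
        rcases ho _ _ _ (hp.2.trans hq.2.symm) (hq.2.trans hr.2.symm) with h | h | h
        · exact hpq (hbinj _ _ h)
        · exact hqr (hbinj _ _ h)
        · exact hpr (hbinj _ _ h))
      have := Finset.card_le_card himg
      omega
    obtain ⟨f, hf, hft⟩ := (Finset.all_card_le_biUnion_card_iff_exists_injective t).1 hall
    have hex : ∀ i : J, ∃ a, o (b i.1 a) ∉ T ∧ o (b i.1 a) = f i := by
      intro i
      have := hft i
      simp only [t, Finset.mem_image, Finset.mem_filter] at this
      obtain ⟨a, ⟨-, h⟩, h'⟩ := this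
      exact ⟨a, h, h'⟩
    choose g hgT hgf using hex
    refine ⟨fun i => if h : A i = Q ∧ b i true ≠ b i false then g ⟨i, h⟩ else true, ?_, ?_⟩
    · intro i k hi hk hne hbi hbk heq
      dsimp only at heq
      rw [dif_pos ⟨hi, hbi⟩, dif_pos ⟨hk, hbk⟩] at heq
      have h1 := hgf ⟨i, hi, hbi⟩
      have h2 := hgf ⟨k, hk, hbk⟩
      have := hf (h1.symm.trans (heq.trans h2))
      exact hne (congrArg Subtype.val this)
    · intro i l hi hbi heq
      dsimp only at heq
      rw [dif_pos ⟨hi, hbi⟩] at heq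
      exact hgT ⟨i, hi, hbi⟩ ⟨l, heq⟩
  have hind : ∀ n : ℕ, ∃ c : ι → Bool,
      (∀ i k, (A i).ncard < n → (A k).ncard < n → i ≠ k → b i true ≠ b i false →
        b k true ≠ b k false → o (b i (c i)) ≠ o (b k (c k))) ∧
      (∀ i l, (A i).ncard < n → b i true ≠ b i false → o (x l (c l)) ≠ o (b i (c i))) := by
    intro n
    induction n with
    | zero => exact ⟨fun _ => true, by simp, by simp⟩
    | succ n ih =>
      obtain ⟨c, hc1, hc2⟩ := ih
      choose c' hcQ hxQ using hstep c
      refine ⟨fun i => if (A i).ncard = n then c' (A i) i else c i, ?_, ?_⟩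
      · intro i k hi hk hne hbi hbk heq
        have hik := hbb _ _ _ _ heq hne
        dsimp only at heq
        by_cases hin : (A i).ncard = n
        · rw [if_pos hin, if_pos (hik ▸ hin), ← hik] at heq
          exact hcQ (A i) i k rfl hik.symm hne hbi hbk heq
        · rw [if_neg hin, if_neg (hik ▸ hin)] at heq
          exact hc1 i k (by omega) (by rw [← hik]; omega) hne hbi hbk heq
      · intro i l hi hbi heq
        have hil := hxb _ _ _ _ heq
        have hll : l ∉ A l := fun h => hA _ _ h h
        have hcard : (A i).ncard = (A l).ncard + 1 := by
          rw [hil, Set.ncard_insert_of_notMem hll (Set.toFinite _)]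
        dsimp only at heq
        -- The parent `l` lies exactly one level above `i`, so this stage does not alter its choice.
        rw [if_neg (by omega : ¬ (A l).ncard = n)] at heq
        by_cases hin : (A i).ncard = n
        · rw [if_pos hin] at heq
          exact hxQ (A i) i l rfl hbi heq
        · rw [if_neg hin] at heq
          exact hc2 i l (by omega) hbi heq
  obtain ⟨c, hc1, hc2⟩ := hind (Fintype.card ι + 1)
  have hlt : ∀ i, (A i).ncard < Fintype.card ι + 1 := fun i => by
    have := Set.ncard_le_card (A i)
    rw [Nat.card_eq_fintype_card] at this
    omega
  exact ⟨c, fun i k => hc1 i k (hlt i) (hlt k), fun i l => hc2 i l (hlt i)⟩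

/-! ### Cycles and edge cuts. -/

namespace Graph

variable {α β : Type*} {G H C : Graph α β} {e : β} {u v : α}

open Relation

lemma mem_of_reflTransGen_adj {X : Set α} (hX : ∀ u v, G.Adj u v → u ∈ X → v ∈ X)
    (h : ReflTransGen G.Adj u v) (hu : u ∈ X) : v ∈ X := by
  induction h with
  | refl => exact hu
  | tail _ hab ih => exact hX _ _ hab ih

lemma reflTransGen_adj_symm (h : ReflTransGen G.Adj u v) : ReflTransGen G.Adj v u := by
  induction h with
  | refl => exact .refl
  | tail _ hab ih => exact .head hab.symm ih

lemma reflTransGen_adj_mono (hle : H ≤ G) (h : ReflTransGen H.Adj u v) :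
    ReflTransGen G.Adj u v := by
  induction h with
  | refl => exact .refl
  | tail _ hab ih => exact ih.tail (hab.mono hle)

lemma finite_setOf_inc (hE : G.edgeSet.Finite) (v : α) : {e | G.Inc e v}.Finite :=
  hE.subset fun _ he => he.edge_mem

lemma finite_edgeSet_of_le (hE : G.edgeSet.Finite) (hle : H ≤ G) : H.edgeSet.Finite :=
  hE.subset (IsSubgraph.edgeSet_mono hle)

/-- The edges leaving a set of vertices of even degree are even in number. -/
lemma even_ncard_boundary [G.Loopless] (hE : G.edgeSet.Finite) {X : Set α} (hX : X.Finite)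
    (hdeg : ∀ v ∈ X, Even (G.degree v)) :
    Even {e | ∃ x y, G.IsLink e x y ∧ x ∈ X ∧ y ∉ X}.ncard := by
  classical
  set B := {e | ∃ x y, G.IsLink e x y ∧ x ∈ X ∧ y ∉ X} with hB
  have hdc := Finset.sum_card_bipartiteAbove_eq_sum_card_bipartiteBelow
    (s := hX.toFinset) (t := hE.toFinset) (fun v e => G.Inc e v)
  have hleft : Even (∑ v ∈ hX.toFinset,
      (hE.toFinset.bipartiteAbove (fun v e => G.Inc e v) v).card) := by
    refine Finset.even_sum _ fun v hv => ?_
    have hcard : (hE.toFinset.bipartiteAbove (fun v e => G.Inc e v) v).card = G.degree v := by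
      rw [degree, ← Set.ncard_coe_finset]
      congr 1
      ext e
      simp only [Finset.coe_bipartiteAbove, Set.Finite.mem_toFinset, Set.mem_ofPred_eq]
      exact ⟨fun h => h.2, fun h => ⟨h.edge_mem, h⟩⟩
    rw [hcard]
    exact hdeg v (hX.mem_toFinset.1 hv)
  rw [hdc, Finset.even_sum_iff_even_card_odd, ← Set.ncard_coe_finset] at hleft
  convert hleft using 2
  ext e
  simp only [Finset.coe_filter, Set.Finite.mem_toFinset, Set.mem_ofPred_eq]
  have key : ∀ x y, G.IsLink e x y →
      hX.toFinset.bipartiteBelow (fun v e => G.Inc e v) e = ({x, y} : Finset α).filter (· ∈ X) := by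
    intro x y hxy
    ext z
    simp only [Finset.mem_bipartiteBelow, Set.Finite.mem_toFinset, Finset.mem_filter,
      Finset.mem_insert, Finset.mem_singleton]
    constructor
    · rintro ⟨hz, hi⟩
      exact ⟨hi.eq_or_eq_of_isLink hxy, hz⟩
    · rintro ⟨rfl | rfl, hz⟩
      exacts [⟨hz, hxy.inc_left⟩, ⟨hz, hxy.inc_right⟩]
  constructor
  · rintro ⟨x, y, hxy, hx, hy⟩
    refine ⟨hxy.edge_mem, ?_⟩
    rw [key x y hxy, Finset.filter_insert, Finset.filter_singleton]
    simp [hx, hy]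
  · rintro ⟨he, hodd⟩
    obtain ⟨x, y, hxy⟩ := G.exists_isLink_of_mem_edgeSet he
    have hne : x ≠ y := hxy.ne
    rw [key x y hxy, Finset.filter_insert, Finset.filter_singleton] at hodd
    by_cases hx : x ∈ X <;> by_cases hy : y ∈ X
    · simp [hx, hy, hne] at hodd
      exact absurd hodd (by decide)
    · exact ⟨x, y, hxy, hx, hy⟩
    · exact ⟨y, x, hxy.symm, hy, hx⟩
    · simp [hx, hy] at hodd

lemma IsCycle.even_ncard_boundary [C.Loopless] (hC : C.IsCycle) (hE : C.edgeSet.Finite)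
    (X : Set α) : Even {e | ∃ x y, C.IsLink e x y ∧ x ∈ X ∧ y ∉ X}.ncard := by
  have h := Graph.even_ncard_boundary hE (hC.1.subset (Set.inter_subset_left (t := X)))
    fun v hv => by rw [hC.2.2 v hv.1]; exact even_two
  convert h using 3
  ext e
  constructor
  · rintro ⟨x, y, h, hx, hy⟩
    exact ⟨x, y, h, ⟨h.left_mem, hx⟩, fun h' => hy h'.2⟩
  · rintro ⟨x, y, h, hx, hy⟩
    exact ⟨x, y, h, hx.2, fun h' => hy ⟨h.right_mem, h'⟩⟩

/-- Deleting an edge of a cycle does not disconnect its ends. -/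
lemma IsCycle.reflTransGen_deleteEdges [C.Loopless] (hC : C.IsCycle) (hE : C.edgeSet.Finite)
    (h : C.IsLink e u v) : ReflTransGen (C.deleteEdges {e}).Adj u v := by
  by_contra hv
  -- Otherwise `e` alone would leave the part reachable from `u`, an odd cut of the cycle.
  have heven := hC.even_ncard_boundary hE {z | ReflTransGen (C.deleteEdges {e}).Adj u z}
  have hB : {f | ∃ x y, C.IsLink f x y ∧ x ∈ {z | ReflTransGen (C.deleteEdges {e}).Adj u z} ∧
      y ∉ {z | ReflTransGen (C.deleteEdges {e}).Adj u z}} = {e} := by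
    ext f
    constructor
    · rintro ⟨x, y, hf, hx, hy⟩
      by_contra hfe
      exact hy (ReflTransGen.tail hx ⟨f, by simpa using ⟨hf, hfe⟩⟩)
    · rintro rfl
      exact ⟨u, v, h, ReflTransGen.refl, hv⟩
  rw [hB, Set.ncard_singleton] at heven
  exact absurd heven (by decide)

/-- A cycle meeting both `R` and its complement has two edges leaving `R`; their ends in `R` can be
taken to be distinct unless the cycle has only one vertex in `R`. -/
lemma IsCycle.exists_boundary_pair [C.Loopless] (hC : C.IsCycle) (hE : C.edgeSet.Finite)
    {R : Set α} {a c : α} (ha : a ∈ C.vertexSet) (haR : a ∈ R) (hc : c ∈ C.vertexSet)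
    (hcR : c ∉ R) :
    ∃ e b x e' b' x', C.IsLink e b x ∧ b ∈ R ∧ x ∉ R ∧ C.IsLink e' b' x' ∧ b' ∈ R ∧ x' ∉ R ∧
      (b = b' → ∀ z ∈ C.vertexSet, z ∈ R → z = b) := by
  have hfirst : ∃ e b x, C.IsLink e b x ∧ b ∈ R ∧ x ∉ R := by
    by_contra! hno
    exact hcR (mem_of_reflTransGen_adj (X := R) (fun u v ⟨e, he⟩ hu => hno e u v he hu)
      (hC.2.1.2 a ha c hc) haR)
  obtain ⟨e, b, x, he, hb, hx⟩ := hfirst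
  by_cases hex : ∃ e' b' x', C.IsLink e' b' x' ∧ b' ∈ R ∧ x' ∉ R ∧ b' ≠ b
  · obtain ⟨e', b', x', h1, h2, h3, h4⟩ := hex
    exact ⟨e, b, x, e', b', x', he, hb, hx, h1, h2, h3, fun h => absurd h.symm h4⟩
  push Not at hex
  -- The same edge may serve twice. By parity a second edge leaves `R`, necessarily from `b`; both
  -- cycle edges at `b` then leave `R`, so no other vertex of the cycle in `R` can reach `b`.
  refine ⟨e, b, x, e, b, x, he, hb, hx, he, hb, hx, fun _ z hz hzR => ?_⟩
  have heven := hC.even_ncard_boundary hE R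
  have heB : e ∈ {e | ∃ x y, C.IsLink e x y ∧ x ∈ R ∧ y ∉ R} := ⟨b, x, he, hb, hx⟩
  have hfin : {e | ∃ x y, C.IsLink e x y ∧ x ∈ R ∧ y ∉ R}.Finite :=
    hE.subset fun f ⟨_, _, h, _⟩ => h.edge_mem
  have hlt : 1 < {e | ∃ x y, C.IsLink e x y ∧ x ∈ R ∧ y ∉ R}.ncard := by
    have : 0 < {e | ∃ x y, C.IsLink e x y ∧ x ∈ R ∧ y ∉ R}.ncard :=
      (Set.ncard_pos hfin).2 ⟨e, heB⟩
    obtain ⟨k, hk⟩ := heven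
    omega
  obtain ⟨e', ⟨b', x', he', hb', hx'⟩, hne⟩ := Set.exists_ne_of_one_lt_ncard hlt e
  obtain rfl := hex e' b' x' he' hb' hx'
  have hinc : ∀ f, C.Inc f b' → f = e ∨ f = e' := by
    intro f hf
    have h2 : {f | C.Inc f b'}.ncard = 2 := hC.2.2 b' he.left_mem
    have hsub : {e, e'} ⊆ {f | C.Inc f b'} := by
      rintro g (rfl | rfl)
      exacts [he.inc_left, he'.inc_left]
    have heq := Set.eq_of_subset_of_ncard_le hsub
      (by rw [h2, Set.ncard_pair hne.symm]) (finite_setOf_inc hE b')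
    have : f ∈ ({e, e'} : Set β) := heq ▸ hf
    simpa using this
  by_contra hzb
  have hmem := mem_of_reflTransGen_adj (X := R \ {b'}) (G := C) ?_
    (hC.2.1.2 z hz b' he.left_mem) ⟨hzR, hzb⟩
  · exact hmem.2 rfl
  rintro p q ⟨f, hf⟩ ⟨hp, hpb⟩
  refine ⟨?_, ?_⟩
  · by_contra hq
    exact hpb (hex f p q hf hp hq)
  · rintro rfl
    obtain rfl | rfl := hinc f hf.inc_right
    · exact hx (hf.symm.right_unique he ▸ hp)
    · exact hx' (hf.symm.right_unique he' ▸ hp)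

/-- Deleting an edge of a cycle of `G` keeps `G` connected. -/
lemma Connected.deleteEdges_of_isCycleOf (hG : G.Connected) [G.Loopless] (hE : G.edgeSet.Finite)
    (hC : C.IsCycleOf G) (he : e ∈ C.edgeSet) : (G.deleteEdges {e}).Connected := by
  have := Loopless.anti hC.1
  refine ⟨by simpa using hG.1, fun x hx y hy => ?_⟩
  have hmono : C.deleteEdges {e} ≤ G.deleteEdges {e} := deleteEdges_mono_left hC.1 _
  have hxy := hG.2 x (by simpa using hx) y (by simpa using hy)
  clear hx hy
  induction hxy with
  | refl => exact .refl
  | @tail p q _ hpq ih =>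
    refine ih.trans ?_
    obtain ⟨f, hf⟩ := hpq
    by_cases hfe : f = e
    · subst hfe
      exact reflTransGen_adj_mono hmono
        (hC.2.reflTransGen_deleteEdges (finite_edgeSet_of_le hE hC.1)
          ((hC.1.isLink_iff he).2 hf))
    · exact .single ⟨f, by simpa using ⟨hf, hfe⟩⟩

end Graph

/-! ### Cubic cycles and vertices of degree two. -/

namespace Graph

variable {α β : Type*} {G H C D : Graph α β} {e f : β} {u v w r : α}

open Relation

/-- Every vertex lies in a component that contains all connected subgraphs through the vertex. -/
lemma exists_isComponentOf (hv : v ∈ H.vertexSet) :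
    ∃ K : Graph α β, K.IsComponentOf H ∧ v ∈ K.vertexSet ∧
      ∀ C : Graph α β, C ≤ H → C.Connected → v ∈ C.vertexSet → C ≤ K := by
  set X : Set α := {z | ReflTransGen H.Adj v z} with hX
  have hXH : X ⊆ H.vertexSet := fun z hz =>
    mem_of_reflTransGen_adj (fun _ _ h _ => h.right_mem) hz hv
  have hle : ∀ C : Graph α β, C ≤ H → C.Connected → v ∈ C.vertexSet → C ≤ H.induce X := by
    intro C hCH hC hvC
    have hsub : ∀ z ∈ C.vertexSet, z ∈ X := fun z hz =>
      reflTransGen_adj_mono hCH (hC.2 v hvC z hz)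
    exact ⟨hsub, fun e x y h => ⟨h.mono hCH, hsub _ h.left_mem, hsub _ h.right_mem⟩⟩
  have hreach : ∀ z ∈ X, ReflTransGen (H.induce X).Adj v z := by
    intro z hz
    have hz' : ReflTransGen H.Adj v z := hz
    clear hz
    induction hz' with
    | refl => exact .refl
    | tail hab hbc ih =>
      obtain ⟨e, he⟩ := hbc
      exact ih.tail ⟨e, he, hab, hab.tail ⟨e, he⟩⟩
  have hconn : (H.induce X).Connected := ⟨⟨v, ReflTransGen.refl⟩, fun x hx y hy =>
    (reflTransGen_adj_symm (hreach x hx)).trans (hreach y hy)⟩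
  refine ⟨H.induce X, ⟨⟨induce_le hXH, hconn⟩, fun K hK hKX => ?_⟩, ReflTransGen.refl, hle⟩
  exact hle K hK.1 hK.2 (hKX.vertexSet_mono ReflTransGen.refl)

/-- The cycles of `G` that avoid the vertices of degree two. -/
def cubicCycles (G : Graph α β) : Set (Graph α β) :=
  {C | C.IsCycleOf (G.deleteVerts (G.verticesOfDegree 2))}

lemma le_of_mem_cubicCycles (hC : C ∈ G.cubicCycles) : C ≤ G :=
  hC.1.trans deleteVerts_le

lemma notMem_verticesOfDegree_of_mem_cubicCycles (hC : C ∈ G.cubicCycles)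
    (hv : v ∈ C.vertexSet) : v ∉ G.verticesOfDegree 2 := by
  have := hC.1.vertexSet_mono hv
  rw [vertexSet_deleteVerts] at this
  exact this.2

lemma notMem_edgeSet_of_inc_degree_two (hC : C ∈ G.cubicCycles) (hw : w ∈ G.verticesOfDegree 2)
    (he : G.Inc e w) : e ∉ C.edgeSet := fun heC =>
  notMem_verticesOfDegree_of_mem_cubicCycles hC
    (((le_of_mem_cubicCycles hC).inc_congr heC).2 he).vertex_mem hw

lemma exists_mem_cubicCycles
    (hthick : (G.deleteVerts (G.verticesOfDegree 2)).IsCollectionOfThickCacti)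
    (hv : v ∈ G.vertexSet) (hv2 : v ∉ G.verticesOfDegree 2) :
    ∃ C ∈ G.cubicCycles, v ∈ C.vertexSet := by
  obtain ⟨K, hK, hvK, -⟩ := exists_isComponentOf (v := v)
    (H := G.deleteVerts (G.verticesOfDegree 2)) (by rw [vertexSet_deleteVerts]; exact ⟨hv, hv2⟩)
  obtain ⟨C, hC, hvC⟩ := (hthick K hK).2 v hvK
  exact ⟨C, ⟨hC.1.trans hK.1.1, hC.2⟩, hvC⟩

namespace SepCycleClass

lemma ncard_inc_le (hG : SepCycleClass 2 3 G) (v : α) : {e | G.Inc e v}.ncard ≤ 3 := by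
  by_cases hv : v ∈ G.vertexSet
  · exact hG.degree_le v hv
  · have : {e | G.Inc e v} = ∅ := Set.eq_empty_of_forall_notMem fun e he => hv he.vertex_mem
    simp [this]

/-- Cubic cycles through a common vertex have a common edge. -/
lemma exists_common_edge (hG : SepCycleClass 2 3 G) (hC : C ∈ G.cubicCycles) (hD : D ∈ G.cubicCycles)
    (hvC : v ∈ C.vertexSet) (hvD : v ∈ D.vertexSet) : ∃ e, e ∈ C.edgeSet ∧ e ∈ D.edgeSet := by
  by_contra! hno
  have hfin := finite_setOf_inc hG.finite_edgeSet v
  have hCs : {e | C.Inc e v} ⊆ {e | G.Inc e v} := fun _ h => h.mono (le_of_mem_cubicCycles hC)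
  have hDs : {e | D.Inc e v} ⊆ {e | G.Inc e v} := fun _ h => h.mono (le_of_mem_cubicCycles hD)
  have hdisj : Disjoint {e | C.Inc e v} {e | D.Inc e v} :=
    Set.disjoint_left.2 fun e h1 h2 => hno e h1.edge_mem h2.edge_mem
  have h1 := Set.ncard_union_eq hdisj (hfin.subset hCs) (hfin.subset hDs)
  have h2 := Set.ncard_le_ncard (Set.union_subset hCs hDs) hfin
  have h3 : {e | C.Inc e v}.ncard = 2 := hC.2.2.2 v hvC
  have h4 : {e | D.Inc e v}.ncard = 2 := hD.2.2.2 v hvD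
  have := hG.ncard_inc_le v
  omega

/-- Cubic cycles with a common vertex coincide if the components of `G - V_2(G)` are cacti. -/
lemma eq_of_mem_of_mem (hG : SepCycleClass 2 3 G)
    (hthick : (G.deleteVerts (G.verticesOfDegree 2)).IsCollectionOfThickCacti)
    (hC : C ∈ G.cubicCycles) (hD : D ∈ G.cubicCycles)
    (hvC : v ∈ C.vertexSet) (hvD : v ∈ D.vertexSet) : C = D := by
  obtain ⟨e, heC, heD⟩ := hG.exists_common_edge hC hD hvC hvD
  obtain ⟨K, hK, -, hle⟩ := exists_isComponentOf (hC.1.vertexSet_mono hvC)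
  have hCK := hle C hC.1 hC.2.2.1 hvC
  have hDK := hle D hD.1 hD.2.2.1 hvD
  exact (hthick K hK).1.2 e (IsSubgraph.edgeSet_mono hCK heC) C D ⟨hCK, hC.2⟩ ⟨hDK, hD.2⟩ heC heD

/-- A vertex of a cubic cycle has at most one edge off the cycle. -/
lemma eq_of_inc_of_notMem (hG : SepCycleClass 2 3 G) (hC : C ∈ G.cubicCycles) (hv : v ∈ C.vertexSet)
    (he : G.Inc e v) (heC : e ∉ C.edgeSet) (hf : G.Inc f v) (hfC : f ∉ C.edgeSet) : e = f := by
  by_contra hne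
  have hfin := finite_setOf_inc hG.finite_edgeSet v
  have hCs : {e | C.Inc e v} ⊆ {e | G.Inc e v} := fun _ h => h.mono (le_of_mem_cubicCycles hC)
  have hdisj : Disjoint {e | C.Inc e v} {e, f} := by
    refine Set.disjoint_left.2 fun g hg hg' => ?_
    obtain rfl | rfl := hg'
    exacts [heC hg.edge_mem, hfC hg.edge_mem]
  have h1 := Set.ncard_union_eq hdisj (hfin.subset hCs) (Set.toFinite _)
  have h2 := Set.ncard_le_ncard (Set.union_subset hCs (t := {e, f}) (by
    rintro g (rfl | rfl)
    exacts [he, hf])) hfin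
  have h3 : {e | C.Inc e v}.ncard = 2 := hC.2.2.2 v hv
  rw [Set.ncard_pair hne] at h1
  have := hG.ncard_inc_le v
  omega

/-- A vertex of a cubic cycle has at most one neighbour of degree two. -/
lemma eq_of_adj_degree_two (hG : SepCycleClass 2 3 G) {w' : α} (hC : C ∈ G.cubicCycles) (hv : v ∈ C.vertexSet)
    (hw : w ∈ G.verticesOfDegree 2) (hw' : w' ∈ G.verticesOfDegree 2)
    (h : G.Adj w v) (h' : G.Adj w' v) : w = w' := by
  obtain ⟨e, he⟩ := h
  obtain ⟨f, hf⟩ := h'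
  obtain rfl := hG.eq_of_inc_of_notMem hC hv he.inc_right
    (notMem_edgeSet_of_inc_degree_two hC hw he.inc_left) hf.inc_right
    (notMem_edgeSet_of_inc_degree_two hC hw' hf.inc_left)
  exact he.left_unique hf

/-- A vertex of degree two has at most two neighbours. -/
lemma eq_or_eq_or_eq_of_adj (hG : SepCycleClass 2 3 G) {x y z : α} (hw : w ∈ G.verticesOfDegree 2)
    (hx : G.Adj w x) (hy : G.Adj w y) (hz : G.Adj w z) : x = y ∨ y = z ∨ x = z := by
  by_contra! hne
  obtain ⟨e, he⟩ := hx
  obtain ⟨f, hf⟩ := hy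
  obtain ⟨g, hg⟩ := hz
  have hef : e ≠ f := by rintro rfl; exact hne.1 (he.right_unique hf)
  have hfg : f ≠ g := by rintro rfl; exact hne.2.1 (hf.right_unique hg)
  have heg : e ≠ g := by rintro rfl; exact hne.2.2 (he.right_unique hg)
  have h1 : ({e, f, g} : Set β).ncard = 3 := Set.ncard_eq_three.2 ⟨e, f, g, hef, heg, hfg, rfl⟩
  have h2 : ({e, f, g} : Set β) ⊆ {e | G.Inc e w} := by
    rintro i (rfl | rfl | rfl)
    exacts [he.inc_left, hf.inc_left, hg.inc_left]
  have h3 := Set.ncard_le_ncard h2 (finite_setOf_inc hG.finite_edgeSet w)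
  have h4 : {e | G.Inc e w}.ncard = 2 := hw.2
  omega

/-- A cycle through a vertex of degree two uses both edges at that vertex. -/
lemma inc_of_isCycleOf (hG : SepCycleClass 2 3 G) {Z : Graph α β} (hZ : Z.IsCycleOf G) (hw : w ∈ G.verticesOfDegree 2)
    (hwZ : w ∈ Z.vertexSet) (he : G.Inc e w) : Z.Inc e w := by
  have h1 : {e | Z.Inc e w} ⊆ {e | G.Inc e w} := fun _ h => h.mono hZ.1
  have h2 : {e | Z.Inc e w}.ncard = 2 := hZ.2.2.2 w hwZ
  have h3 : {e | G.Inc e w}.ncard = 2 := hw.2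
  have h4 := Set.eq_of_subset_of_ncard_le h1 (by omega) (finite_setOf_inc hG.finite_edgeSet w)
  exact (Set.ext_iff.1 h4 e).2 he

end SepCycleClass

/-! ### The side of a cubic cycle that contains the root. -/

/-- The vertices that can be reached from `r` without using edges of `C`. -/
def rootSide (G : Graph α β) (r : α) (C : Graph α β) : Set α :=
  {z | ReflTransGen (G.deleteEdges C.edgeSet).Adj r z}

lemma mem_rootSide_of_isLink (h : G.IsLink e u v) (he : e ∉ C.edgeSet)
    (hu : u ∈ G.rootSide r C) : v ∈ G.rootSide r C :=
  ReflTransGen.tail hu ⟨e, by simpa using ⟨h, he⟩⟩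

lemma exists_mem_rootSide (hconn : G.Connected) (hr : r ∈ G.vertexSet) (hCG : C ≤ G)
    (hC : C.vertexSet.Nonempty) : ∃ a ∈ C.vertexSet, a ∈ G.rootSide r C := by
  by_contra! hno
  obtain ⟨a, ha⟩ := hC
  refine hno a ha (mem_of_reflTransGen_adj (G := G) ?_ (hconn.2 r hr a (hCG.vertexSet_mono ha))
    ReflTransGen.refl)
  rintro u v ⟨e, he⟩ hu
  exact mem_rootSide_of_isLink he
    (fun heC => hno u ((hCG.isLink_iff heC).2 he).left_mem hu) hu

/-- If all of `C` were on the root side, a walk from `r` could never leave that side, and `G - E(C)`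
would be connected. -/
lemma exists_notMem_rootSide (hconn : G.Connected) (hr : r ∈ G.vertexSet) (hCG : C ≤ G)
    (hsep : ¬ (G.deleteEdges C.edgeSet).Connected) : ∃ c ∈ C.vertexSet, c ∉ G.rootSide r C := by
  by_contra! hall
  have hreach : ∀ v ∈ G.vertexSet, v ∈ G.rootSide r C := by
    intro v hv
    refine mem_of_reflTransGen_adj (G := G) ?_ (hconn.2 r hr v hv) ReflTransGen.refl
    rintro u v ⟨e, he⟩ hu
    by_cases heC : e ∈ C.edgeSet
    · exact hall v ((hCG.isLink_iff heC).2 he).right_mem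
    · exact mem_rootSide_of_isLink he heC hu
  exact hsep ⟨⟨r, by simpa using hr⟩, fun x hx y hy =>
    (reflTransGen_adj_symm (hreach x (by simpa using hx))).trans (hreach y (by simpa using hy))⟩

/-- A vertex of degree two is on the same side of a cubic cycle as its neighbours. -/
lemma mem_rootSide_iff_of_adj (hC : C ∈ G.cubicCycles) (hw : w ∈ G.verticesOfDegree 2)
    (h : G.Adj w v) : v ∈ G.rootSide r C ↔ w ∈ G.rootSide r C := by
  obtain ⟨e, he⟩ := h
  have heC := notMem_edgeSet_of_inc_degree_two hC hw he.inc_left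
  exact ⟨mem_rootSide_of_isLink he.symm heC, mem_rootSide_of_isLink he heC⟩

/-- A connected graph without edges in `C` lies on one side of `C`. -/
lemma mem_rootSide_of_connected (hDG : D ≤ G) (hD : D.Connected)
    (hdisj : Disjoint D.edgeSet C.edgeSet) (hu : u ∈ D.vertexSet) (hv : v ∈ D.vertexSet)
    (huR : u ∈ G.rootSide r C) : v ∈ G.rootSide r C := by
  refine mem_of_reflTransGen_adj (G := D) ?_ (hD.2 u hu v hv) huR
  rintro p q ⟨e, he⟩ hp
  exact mem_rootSide_of_isLink (he.mono hDG) (Set.disjoint_left.1 hdisj he.edge_mem) hp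

/-- If `b` is the only vertex of the cubic cycle `C` on the root side of `C`, then a neighbour of
`b` of degree two lies on no cycle. -/
lemma SepCycleClass.notMem_cycle_of_unique (hG : SepCycleClass 2 3 G) (hC : C ∈ G.cubicCycles)
    {b : α} (hb : b ∈ C.vertexSet) (hbR : b ∈ G.rootSide r C)
    (huniq : ∀ z ∈ C.vertexSet, z ∈ G.rootSide r C → z = b)
    (hw : w ∈ G.verticesOfDegree 2) (hwb : G.Adj w b) {Z : Graph α β} (hZ : Z.IsCycleOf G) :
    w ∉ Z.vertexSet := by
  intro hwZ
  have := hG.loopless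
  have := Loopless.anti hZ.1
  obtain ⟨e, he⟩ := hwb
  have heC := notMem_edgeSet_of_inc_degree_two hC hw he.inc_left
  have heZ : Z.IsLink e w b :=
    (hZ.1.isLink_iff (hG.inc_of_isCycleOf hZ hw hwZ he.inc_left).edge_mem).2 he
  have hreach := hZ.2.reflTransGen_deleteEdges (finite_edgeSet_of_le hG.finite_edgeSet hZ.1) heZ
  -- Without `e` a walk from `w` cannot leave the root side, since only `b` has edges of `C` there,
  -- and cannot enter `b`, whose only edge off `C` is `e`.
  have hmem : b ∈ G.rootSide r C \ {b} := by
    refine mem_of_reflTransGen_adj ?_ hreach ⟨mem_rootSide_of_isLink he.symm heC hbR, he.ne⟩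
    rintro p q ⟨g, hg⟩ ⟨hp, hpb⟩
    rw [deleteEdges_isLink] at hg
    have hgG := hg.1.mono hZ.1
    have hgC : g ∉ C.edgeSet := fun h =>
      hpb (huniq p (((le_of_mem_cubicCycles hC).isLink_iff h).2 hgG).left_mem hp)
    refine ⟨mem_rootSide_of_isLink hgG hgC hp, ?_⟩
    rintro rfl
    exact hg.2 (hG.eq_of_inc_of_notMem hC hb hgG.inc_right hgC he.inc_right heC)
  exact hmem.2 rfl

/-! ### The choice of one edge per cubic cycle. -/

/-- Choice of one edge in each cubic cycle such that no vertex of degree two lying on a cycle has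
two distinct neighbours that are ends of chosen edges. -/
lemma SepCycleClass.exists_edge_choice (hG : SepCycleClass 2 3 G)
    (hthick : (G.deleteVerts (G.verticesOfDegree 2)).IsCollectionOfThickCacti) :
    ∃ φ : G.cubicCycles → β, (∀ C, φ C ∈ C.1.edgeSet) ∧
      ∀ C D s t w, G.Inc (φ C) s → G.Inc (φ D) t → s ≠ t → w ∈ G.verticesOfDegree 2 →
        G.Adj w s → G.Adj w t → ∀ Z : Graph α β, Z.IsCycleOf G → w ∉ Z.vertexSet := by
  classical
  have hloop := hG.loopless
  obtain ⟨r, hr⟩ := hG.connected.1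
  have hne : ∀ C : G.cubicCycles, C.1.vertexSet.Nonempty := fun C => C.2.2.2.1.1
  have hle : ∀ C : G.cubicCycles, C.1 ≤ G := fun C => le_of_mem_cubicCycles C.2
  have hdisj : ∀ (C D : G.cubicCycles) (v : α), v ∈ C.1.vertexSet → v ∈ D.1.vertexSet → C = D :=
    fun C D v hv hv' => Subtype.ext (hG.eq_of_mem_of_mem hthick C.2 D.2 hv hv')
  have hfin : Finite G.cubicCycles := by
    have : Finite {X : Set α // X ⊆ G.vertexSet} := hG.finite_vertexSet.finite_subsets.to_subtype
    refine Finite.of_injective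
      (β := {X : Set α // X ⊆ G.vertexSet}) (fun C => ⟨C.1.vertexSet, (hle C).vertexSet_mono⟩) ?_
    intro C D h
    obtain ⟨v, hv⟩ := hne C
    have h' : C.1.vertexSet = D.1.vertexSet := congrArg Subtype.val h
    exact hdisj C D v hv (h' ▸ hv)
  let R : G.cubicCycles → Set α := fun C => G.rootSide r C.1
  have hmeet : ∀ C, ∃ a ∈ C.1.vertexSet, a ∈ R C := fun C =>
    exists_mem_rootSide hG.connected hr (hle C) (hne C)
  have hmiss : ∀ C, ∃ c ∈ C.1.vertexSet, c ∉ R C := fun C =>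
    exists_notMem_rootSide hG.connected hr (hle C) (hG.separating C.1 ⟨hle C, C.2.2⟩)
  have hside : ∀ C D u v, C ≠ D → u ∈ D.1.vertexSet → v ∈ D.1.vertexSet → u ∈ R C → v ∈ R C := by
    intro C D u v hCD hu hv
    refine mem_rootSide_of_connected (hle D) D.2.2.2.1 ?_ hu hv
    refine Set.disjoint_left.2 fun e heD heC => hCD ?_
    obtain ⟨x, y, hxy⟩ := D.1.exists_isLink_of_mem_edgeSet heD
    exact hdisj C D x (((hle C).isLink_iff heC).2 (hxy.mono (hle D))).left_mem hxy.left_mem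
  -- The ancestors of `C`: the cycles `D` that cut all of `C` off from `r`.
  let A : G.cubicCycles → Set G.cubicCycles := fun C => {D | ∀ z ∈ C.1.vertexSet, z ∉ R D}
  have hA : ∀ C D, C ∈ A D → D ∉ A C := by
    intro C D hC hD
    obtain ⟨v, hv⟩ := hne C
    -- If each cycle misses the other's root side, `R C ∩ R D` is closed under adjacency: leaving `R
    -- C` needs a vertex of `C` in `R D`, and vice versa.
    have hmem : v ∈ R C ∩ R D := by
      refine mem_of_reflTransGen_adj (G := G) ?_
        (hG.connected.2 r hr v ((hle C).vertexSet_mono hv)) ⟨.refl, .refl⟩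
      rintro p q ⟨e, he⟩ ⟨hpC, hpD⟩
      exact ⟨mem_rootSide_of_isLink he
          (fun h => hD p (((hle C).isLink_iff h).2 he).left_mem hpD) hpC,
        mem_rootSide_of_isLink he
          (fun h => hC p (((hle D).isLink_iff h).2 he).left_mem hpC) hpD⟩
    exact hD v hv hmem.2
  have hmemA : ∀ C D v, v ∈ C.1.vertexSet → D ≠ C → (D ∈ A C ↔ v ∉ R D) := fun C D v hv hDC =>
    ⟨fun h => h v hv, fun h z hz hzR => h (hside D C z v hDC hz hv hzR)⟩
  have hselfA : ∀ C, C ∉ A C := fun C h => hA C C h h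
  have hpair : ∀ C : G.cubicCycles, ∃ (ε : Bool → β) (b x : Bool → α),
      (∀ a, C.1.IsLink (ε a) (b a) (x a) ∧ b a ∈ R C ∧ x a ∉ R C) ∧
      (b true = b false → ∀ a, ∀ z ∈ C.1.vertexSet, z ∈ R C → z = b a) := by
    intro C
    have := Loopless.anti (hle C)
    obtain ⟨a, ha, haR⟩ := hmeet C
    obtain ⟨c, hc, hcR⟩ := hmiss C
    obtain ⟨e, b, x, e', b', x', h1, h2, h3, h4, h5, h6, h7⟩ := C.2.2.exists_boundary_pair
      (finite_edgeSet_of_le hG.finite_edgeSet (hle C)) ha haR hc hcR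
    refine ⟨fun a => cond a e e', fun a => cond a b b', fun a => cond a x x', ?_, ?_⟩
    · rintro (_ | _)
      exacts [⟨h4, h5, h6⟩, ⟨h1, h2, h3⟩]
    · intro hbb a z hz hzR
      have hbb' : b = b' := hbb
      have hzb := h7 hbb' z hz hzR
      cases a
      exacts [hzb.trans hbb', hzb]
  choose ε b x hlink huniq using hpair
  -- The label of a vertex is a neighbour of degree two, unique on cubic cycles, or else the vertex
  -- itself; equal labels on distinct vertices thus mean a common neighbour of degree two.
  let o : α → α ⊕ α := fun v =>
    if h : ∃ w ∈ G.verticesOfDegree 2, G.Adj w v then .inr h.choose else .inl v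
  have ho_eq : ∀ u v, o u = o v → u ≠ v →
      ∃ w ∈ G.verticesOfDegree 2, G.Adj w u ∧ G.Adj w v ∧ o u = .inr w := by
    intro u v huv hne
    by_cases hu : ∃ w ∈ G.verticesOfDegree 2, G.Adj w u <;>
      by_cases hv : ∃ w ∈ G.verticesOfDegree 2, G.Adj w v
    · have hu' : o u = .inr hu.choose := dif_pos hu
      have hv' : o v = .inr hv.choose := dif_pos hv
      have heq : hu.choose = hv.choose := Sum.inr_injective (hu' ▸ huv.trans hv')
      exact ⟨hu.choose, hu.choose_spec.1, hu.choose_spec.2, heq ▸ hv.choose_spec.2, hu'⟩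
    all_goals simp only [o, hu, hv, dif_pos, dif_neg, not_false_eq_true] at huv
    · simp at huv
    · simp at huv
    · exact absurd (Sum.inl_injective huv) hne
  have ho_inr : ∀ (C : G.cubicCycles) s w, s ∈ C.1.vertexSet → w ∈ G.verticesOfDegree 2 →
      G.Adj w s → o s = .inr w := by
    intro C s w hs hw hws
    have h : ∃ w ∈ G.verticesOfDegree 2, G.Adj w s := ⟨w, hw, hws⟩
    have h' : o s = .inr h.choose := dif_pos h
    rw [h', hG.eq_of_adj_degree_two C.2 hs h.choose_spec.1 hw h.choose_spec.2 hws]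
  have hbV : ∀ C a, b C a ∈ C.1.vertexSet := fun C a => (hlink C a).1.left_mem
  have hxV : ∀ C a, x C a ∈ C.1.vertexSet := fun C a => (hlink C a).1.right_mem
  have hsame : ∀ (C : G.cubicCycles) s t w, w ∈ G.verticesOfDegree 2 → G.Adj w s → G.Adj w t →
      (s ∈ R C ↔ t ∈ R C) := fun C s t w hw hs ht =>
    (mem_rootSide_iff_of_adj C.2 hw hs).trans (mem_rootSide_iff_of_adj C.2 hw ht).symm
  have hbA : ∀ C D a, D ∈ A C ↔ b C a ∉ R D := by
    intro C D a
    by_cases hDC : D = C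
    · subst hDC
      exact ⟨fun h => absurd h (hselfA D), fun h => absurd (hlink D a).2.1 h⟩
    · exact hmemA C D _ (hbV C a) hDC
  -- The `x`-end is cut off from `r` by the ancestors of `C` and by `C` itself; the `b`-end by the
  -- ancestors alone.
  have hxA : ∀ C D a, D ∈ insert C (A C) ↔ x C a ∉ R D := by
    intro C D a
    by_cases hDC : D = C
    · subst hDC
      exact ⟨fun _ => (hlink D a).2.2, fun _ => Set.mem_insert _ _⟩
    · rw [Set.mem_insert_iff, or_iff_right hDC]
      exact hmemA C D _ (hxV C a) hDC
  have hbx : ∀ C D a a', b C a ≠ x D a' := by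
    intro C D a a' h
    obtain rfl := hdisj C D _ (hbV C a) (h ▸ hxV D a')
    exact (hlink C a').2.2 (h ▸ (hlink C a).2.1)
  obtain ⟨c, hc1, hc2⟩ := exists_bool_choice A b x o
    (fun C D a a' h => hdisj C D _ (hbV C a) (h ▸ hbV D a')) hbx
    (by
      intro u v t huv hvt
      by_contra! hne
      obtain ⟨w, hw, hwu, hwv, hu⟩ := ho_eq u v huv hne.1
      obtain ⟨w', hw', hwv', hwt, hv⟩ := ho_eq v t hvt hne.2.1
      obtain rfl : w = w' := Sum.inr_injective (hu.symm.trans (huv.trans hv))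
      have := hG.eq_or_eq_or_eq_of_adj hw hwu hwv hwt
      tauto)
    (by
      intro C D a a' h hCD
      obtain ⟨w, hw, h1, h2, -⟩ := ho_eq _ _ h
        (fun h => hCD (hdisj C D _ (hbV C a) (h ▸ hbV D a')))
      ext E
      rw [hbA C E a, hbA D E a', hsame E _ _ w hw h1 h2])
    (by
      intro D C a a' h
      obtain ⟨w, hw, h1, h2, -⟩ := ho_eq _ _ h (hbx _ _ _ _).symm
      ext E
      rw [hbA C E a', hxA D E a, hsame E _ _ w hw h1 h2])
    hA
  have hsingle : ∀ C w, b C true = b C false → w ∈ G.verticesOfDegree 2 → G.Adj w (b C (c C)) →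
      ∀ Z : Graph α β, Z.IsCycleOf G → w ∉ Z.vertexSet := fun C w h hw hwb Z hZ =>
    hG.notMem_cycle_of_unique C.2 (hbV C _) (hlink C _).2.1 (huniq C h _) hw hwb hZ
  refine ⟨fun C => ε C (c C), fun C => (hlink C _).1.edge_mem, ?_⟩
  intro C D s t w hs ht hst hw hws hwt Z hZ
  have hbxc : ∀ C D, G.Adj w (b C (c C)) → G.Adj w (x D (c D)) → w ∉ Z.vertexSet := by
    intro C D hb hx
    by_cases hC : b C true = b C false
    · exact hsingle C w hC hw hb Z hZ
    · refine absurd ?_ (hc2 C D hC)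
      rw [ho_inr D _ w (hxV D _) hw hx, ho_inr C _ w (hbV C _) hw hb]
  rcases hs.eq_or_eq_of_isLink ((hlink C (c C)).1.mono (hle C)) with rfl | rfl <;>
    rcases ht.eq_or_eq_of_isLink ((hlink D (c D)).1.mono (hle D)) with rfl | rfl
  · have hCD : C ≠ D := by rintro rfl; exact hst rfl
    by_cases hC : b C true = b C false
    · exact hsingle C w hC hw hws Z hZ
    by_cases hD : b D true = b D false
    · exact hsingle D w hD hw hwt Z hZ
    refine absurd ?_ (hc1 C D hCD hC hD)
    rw [ho_inr C _ w (hbV C _) hw hws, ho_inr D _ w (hbV D _) hw hwt]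
  · exact hbxc C D hws hwt
  · exact hbxc D C hwt hws
  -- Two `x`-ends never clash: each cycle would be an ancestor of the other.
  · have hCD : C ≠ D := by rintro rfl; exact hst rfl
    have h1 : D ∈ insert C (A C) :=
      (hxA C D (c C)).2 fun h => (hlink D _).2.2 ((hsame D _ _ w hw hws hwt).1 h)
    have h2 : C ∈ insert D (A D) :=
      (hxA D C (c D)).2 fun h => (hlink C _).2.2 ((hsame C _ _ w hw hws hwt).2 h)
    exact absurd (h2.resolve_left hCD) (hA D C (h1.resolve_left hCD.symm))

end Graph

/-! ### The spanning tree and the matching. -/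

namespace Graph

variable {α β : Type*} {G : Graph α β} {e f : β} {v w : α}

open Relation

/-- Deleting one edge from each cubic cycle keeps the graph connected. -/
lemma SepCycleClass.connected_deleteEdges_range (hG : SepCycleClass 2 3 G)
    (hthick : (G.deleteVerts (G.verticesOfDegree 2)).IsCollectionOfThickCacti)
    {φ : G.cubicCycles → β} (hφ : ∀ C, φ C ∈ C.1.edgeSet) :
    (G.deleteEdges (Set.range φ)).Connected := by
  have := hG.loopless
  refine ⟨by simpa using hG.connected.1, fun x hx y hy => ?_⟩
  have hxy := hG.connected.2 x (by simpa using hx) y (by simpa using hy)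
  clear hx hy
  induction hxy with
  | refl => exact .refl
  | @tail p q _ hpq ih =>
    refine ih.trans ?_
    obtain ⟨e, he⟩ := hpq
    by_cases heF : e ∈ Set.range φ
    · obtain ⟨C, rfl⟩ := heF
      have hCG := le_of_mem_cubicCycles C.2
      have := Loopless.anti hCG
      -- The rest of `C` bypasses `φ C`, and by disjointness no other deleted edge lies on `C`.
      refine reflTransGen_adj_mono ⟨by simpa using hCG.vertexSet_mono, fun g a b hg => ?_⟩
        (C.2.2.reflTransGen_deleteEdges (finite_edgeSet_of_le hG.finite_edgeSet hCG)
          ((hCG.isLink_iff (hφ C)).2 he))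
      rw [deleteEdges_isLink] at hg ⊢
      refine ⟨hg.1.mono hCG, ?_⟩
      rintro ⟨D, rfl⟩
      refine hg.2 (congrArg φ (Subtype.ext ?_))
      exact hG.eq_of_mem_of_mem hthick D.2 C.2
        (((le_of_mem_cubicCycles D.2).isLink_iff (hφ D)).2 (hg.1.mono hCG)).left_mem
        hg.1.left_mem
    · exact .single ⟨e, by simpa using ⟨he, by simpa using heF⟩⟩

end Graph

theorem theorem1p3 {α β : Type*} (G : Graph α β) (hG : Graph.SepCycleClass 2 3 G)
    (hthick : (G.deleteVerts (G.verticesOfDegree 2)).IsCollectionOfThickCacti) :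
    G.DecomposesIntoSpanningTreeAndMatching := by
  open Graph in
  have hloop := hG.loopless
  obtain ⟨φ, hφ, hsel⟩ := hG.exists_edge_choice hthick
  have hdisj : ∀ (C D : G.cubicCycles) (v : α), v ∈ C.1.vertexSet → v ∈ D.1.vertexSet → C = D :=
    fun C D v hv hv' => Subtype.ext (hG.eq_of_mem_of_mem hthick C.2 D.2 hv hv')
  have hφinc : ∀ C v, G.Inc (φ C) v → C.1.Inc (φ C) v := fun C v h =>
    ((le_of_mem_cubicCycles C.2).inc_congr (hφ C)).2 h
  set F : Set β := Set.range φ with hF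
  let S : Set α := {v | ∃ C, G.Inc (φ C) v}
  let A : Set β :=
    {e | e ∈ G.edgeSet ∧ (∃ w ∈ G.verticesOfDegree 2, G.Inc e w) ∧ ∀ v, G.Inc e v → v ∉ S}
  have hfin : {N : Set β | N ⊆ A ∧ (G.deleteEdges (F ∪ N)).Connected}.Finite :=
    (hG.finite_edgeSet.subset fun e (he : e ∈ A) => he.1).finite_subsets.subset fun N hN => hN.1
  obtain ⟨N, hN⟩ := hfin.exists_maximal ⟨∅, Set.empty_subset _, by
    rw [Set.union_empty]; exact hG.connected_deleteEdges_range hthick hφ⟩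
  have hNA : N ⊆ A := hN.1.1
  have hTconn : (G.deleteEdges (F ∪ N)).Connected := hN.1.2
  have hS2 : ∀ w ∈ G.verticesOfDegree 2, w ∉ S := fun w hw ⟨C, hC⟩ =>
    notMem_verticesOfDegree_of_mem_cubicCycles C.2 (hφinc C w hC).vertex_mem hw
  have hFG : F ⊆ G.edgeSet := by
    rintro _ ⟨C, rfl⟩
    exact IsSubgraph.edgeSet_mono (le_of_mem_cubicCycles C.2) (hφ C)
  refine ⟨G.deleteEdges (F ∪ N), F ∪ N, ⟨deleteEdges_le, rfl⟩, ⟨hTconn, fun Z hZ => ?_⟩, ⟨?_, ?_⟩,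
    ?_, ?_⟩
  · have hTloop : (G.deleteEdges (F ∪ N)).Loopless := Loopless.anti deleteEdges_le
    have hZG : Z.IsCycleOf G := ⟨hZ.1.trans deleteEdges_le, hZ.2⟩
    have hZT : ∀ e ∈ Z.edgeSet, e ∉ F ∪ N := fun e he =>
      (IsSubgraph.edgeSet_mono hZ.1 he).2
    -- An edge of `A` on the cycle `Z` could be added to `N`, against maximality.
    have hZA : ∀ e ∈ Z.edgeSet, e ∉ A := by
      intro e he heA
      have hconn := hTconn.deleteEdges_of_isCycleOf
        (finite_edgeSet_of_le hG.finite_edgeSet deleteEdges_le) hZ he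
      rw [deleteEdges_deleteEdges, Set.union_assoc] at hconn
      have hle := hN.2 (y := N ∪ {e})
        ⟨Set.union_subset hNA (Set.singleton_subset_iff.2 heA), hconn⟩ Set.subset_union_left
      exact hZT e he (Or.inr (hle (Or.inr rfl)))
    by_cases hZ2 : ∃ w ∈ Z.vertexSet, w ∈ G.verticesOfDegree 2
    · obtain ⟨w, hwZ, hw⟩ := hZ2
      have hend : ∀ e y, G.IsLink e w y → y ∈ S := by
        intro e y he
        by_contra hy
        refine hZA e (hG.inc_of_isCycleOf hZG hw hwZ he.inc_left).edge_mem
          ⟨he.edge_mem, ⟨w, hw, he.inc_left⟩, fun v hv => ?_⟩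
        obtain rfl | rfl := hv.eq_or_eq_of_isLink he
        exacts [hS2 v hw, hy]
      have hdeg : {e | G.Inc e w}.ncard = 2 := hw.2
      obtain ⟨e, f, hef, hset⟩ := Set.ncard_eq_two.1 hdeg
      obtain ⟨x, hx⟩ : G.Inc e w := (Set.ext_iff.1 hset e).2 (Or.inl rfl)
      obtain ⟨y, hy⟩ : G.Inc f w := (Set.ext_iff.1 hset f).2 (Or.inr rfl)
      obtain ⟨C, hC⟩ := hend e x hx
      obtain ⟨D, hD⟩ := hend f y hy
      refine hsel C D x y w hC hD ?_ hw hx.adj hy.adj Z hZG hwZ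
      -- If the two edges at `w` were parallel, `x` would have two edges off its cubic cycle.
      rintro rfl
      exact hef (hG.eq_of_inc_of_notMem C.2 (hφinc C x hC).vertex_mem
        hx.inc_right (notMem_edgeSet_of_inc_degree_two C.2 hw hx.inc_left)
        hy.inc_right (notMem_edgeSet_of_inc_degree_two C.2 hw hy.inc_left))
    · push Not at hZ2
      have hZmem : Z ∈ G.cubicCycles := by
        refine ⟨⟨?_, fun e x y h => ?_⟩, hZ.2⟩
        · rw [vertexSet_deleteVerts]
          exact fun v hv => ⟨hZG.1.vertexSet_mono hv, hZ2 v hv⟩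
        · exact (deleteVerts_isLink G _).2 ⟨h.mono hZG.1, hZ2 x h.left_mem, hZ2 y h.right_mem⟩
      exact hZT _ (hφ ⟨Z, hZmem⟩) (Or.inl ⟨⟨Z, hZmem⟩, rfl⟩)
  · exact Set.union_subset hFG fun e he => (hNA he).1
  · have hFN : ∀ e ∈ F, ∀ f ∈ N, ∀ v, G.Inc e v → ¬ G.Inc f v := by
      rintro _ ⟨C, rfl⟩ f hf v he hfv
      exact (hNA hf).2.2 v hfv ⟨C, he⟩
    rintro e (he | he) f (hf | hf) v hev hfv
    · obtain ⟨C, rfl⟩ := he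
      obtain ⟨D, rfl⟩ := hf
      rw [hdisj C D v (hφinc C v hev).vertex_mem (hφinc D v hfv).vertex_mem]
    · exact absurd hfv (hFN e he f hf v hev)
    · exact absurd hev (hFN f hf e he v hfv)
    · by_contra hne
      -- Two edges of `N` would isolate a vertex of degree two; a vertex of degree 3 has only one
      -- edge off its cubic cycle, and edges of `N` lie off it.
      by_cases hv : v ∈ G.verticesOfDegree 2
      · have hdeg : {e | G.Inc e v}.ncard = 2 := hv.2
        have hsub : {e, f} ⊆ {e | G.Inc e v} := by
          rintro g (rfl | rfl)
          exacts [hev, hfv]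
        have heq := Set.eq_of_subset_of_ncard_le hsub
          (by rw [hdeg, Set.ncard_pair hne]) (finite_setOf_inc hG.finite_edgeSet v)
        obtain ⟨y, hy⟩ := hev
        have hreach := hTconn.2 v (by simpa using hy.left_mem) y (by simpa using hy.right_mem)
        have := mem_of_reflTransGen_adj (X := {v}) ?_ hreach rfl
        · exact hy.ne (Set.mem_singleton_iff.1 this).symm
        rintro p q ⟨g, hg⟩ rfl
        rw [deleteEdges_isLink] at hg
        have hgm : g ∈ ({e, f} : Set β) := heq ▸ hg.1.inc_left
        obtain rfl | rfl := hgm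
        exacts [absurd (Or.inr he) hg.2, absurd (Or.inr hf) hg.2]
      · obtain ⟨C, hC, hvC⟩ := exists_mem_cubicCycles hthick hev.vertex_mem hv
        obtain ⟨w, hw, hew⟩ := (hNA he).2.1
        obtain ⟨w', hw', hfw⟩ := (hNA hf).2.1
        exact hne (hG.eq_of_inc_of_notMem hC hvC
          hev (notMem_edgeSet_of_inc_degree_two hC hw hew)
          hfv (notMem_edgeSet_of_inc_degree_two hC hw' hfw))
  · exact Set.disjoint_left.2 fun e he he' => he.2 he'
  · exact Set.sdiff_union_of_subset (Set.union_subset hFG fun e he => (hNA he).1)
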